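/- Let $\beta>1$. Let $(c_i)_{i\ge 1}$ be the points, enumerated in decreasing order, of a Poisson point process on $\mathbb{R}$ with intensity $e^{-x}\,dx$. Then almost surely $\sum_j e^{\beta c_j}<\infty$, and the random sequence $$v_i=\frac{e^{\beta c_i}}{\sum_{j\ge1} e^{\beta c_j}},\qquad i\ge 1,$$ has the Poisson–Dirichlet distribution $PD(1/\beta,0)$. Here, for $0<m<1$, $PD(m,0)$ denotes the distribution of the sequence $\bigl(\pi(i)/\sum_{j\ge1}\pi(j)\bigr)_{i\ge1}$, where $\pi(1)\ge\pi(2)\ge\cdots$ are the points, in decreasing order, of a Poisson point process on $(0,\infty)$ with intensity $x^{-m-1}\,dx$. Such a process exists, its points are almost surely summable, and the distribution of the normalized sequence is the same for every such process. -/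

import Mathlib

open MeasureTheory ProbabilityTheory Set
open scoped ENNReal

/-- `N` is a Poisson point process on `E` with intensity measure `μ`, under the probability `P`.
The random configuration of points is encoded by its counting measure: `N ω A` is the number of
points in `A`. -/
structure IsPoissonPointProcess {Ω E : Type*} [MeasurableSpace Ω] [MeasurableSpace E]
    (N : Ω → Measure E) (μ : Measure E) (P : Measure Ω) : Prop where
  /-- `N` is a random measure, that is, all counts `N A` are random variables. -/
  measurable : Measurable N
  /-- `N` takes values in `{0, 1, 2, …, ∞}`. -/
  integer_valued : ∀ᵐ ω ∂P, ∀ A : Set E, MeasurableSet A → ∃ k : ℕ∞, N ω A = (k : ℝ≥0∞)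
  /-- If `μ A < ∞`, then `N A` is a Poisson random variable with mean `μ A`. -/
  hasLaw_poisson : ∀ A : Set E, MeasurableSet A → μ A ≠ ∞ →
    HasLaw (fun ω => N ω A)
      ((poissonMeasure (μ A).toNNReal).map (fun n : ℕ => (n : ℝ≥0∞))) P
  /-- If `μ A = ∞`, then `A` contains infinitely many points almost surely. -/
  infinite_of_infinite : ∀ A : Set E, MeasurableSet A → μ A = ∞ → ∀ᵐ ω ∂P, N ω A = ∞
  /-- Numbers of points in finitely many pairwise disjoint sets are independent. -/
  indep : ∀ (n : ℕ) (A : Fin n → Set E), (∀ i, MeasurableSet (A i)) →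
    Pairwise (fun i j => Disjoint (A i) (A j)) → iIndepFun (fun i ω => N ω (A i)) P

/-- The random variables `c 0 ≥ c 1 ≥ c 2 ≥ …` enumerate, almost surely, the points of the point
process `N` on the real line, each with its multiplicity. -/
structure IsDecreasingEnumeration {Ω : Type*} [MeasurableSpace Ω]
    (c : ℕ → Ω → ℝ) (N : Ω → Measure ℝ) (P : Measure Ω) : Prop where
  aemeasurable : ∀ i, AEMeasurable (c i) P
  antitone : ∀ᵐ ω ∂P, Antitone (fun i => c i ω)
  eq_sum_dirac : ∀ᵐ ω ∂P, N ω = Measure.sum (fun i => Measure.dirac (c i ω))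

/-- The sequence `x` divided by its sum. -/
noncomputable def normalizeSeq (x : ℕ → ℝ) : ℕ → ℝ := fun i => x i / ∑' j, x j

/-- The measure `e^{-x} dx` on `ℝ`. -/
noncomputable def expIntensity : Measure ℝ :=
  volume.withDensity (fun x => ENNReal.ofReal (Real.exp (-x)))

/-- The measure `x^{-m-1} dx` on `(0, ∞)`, as a measure on `ℝ` that gives no mass to `(-∞, 0]`. -/
noncomputable def powerIntensity (m : ℝ) : Measure ℝ :=
  (volume.restrict (Ioi 0)).withDensity (fun x => ENNReal.ofReal (x ^ (-m - 1)))

/-- `ν` is the Poisson–Dirichlet distribution `PD(m, 0)`: the law of `(π i / ∑ j, π j)_i`, where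
`π` is the decreasing enumeration of a Poisson point process on `(0, ∞)` with intensity
`x^{-m-1} dx`. It is part of the definition that such a process exists, and that for each of them
the points are almost surely summable and the law of the normalized sequence is `ν`. -/
structure IsPoissonDirichlet (m : ℝ) (ν : Measure (ℕ → ℝ)) : Prop where
  exists_process : ∃ (Ω : Type) (_ : MeasurableSpace Ω) (P : Measure Ω) (N : Ω → Measure ℝ)
    (π : ℕ → Ω → ℝ), IsProbabilityMeasure P ∧ IsPoissonPointProcess N (powerIntensity m) P ∧
      IsDecreasingEnumeration π N P
  hasLaw_normalizeSeq : ∀ (Ω : Type) [MeasurableSpace Ω] (P : Measure Ω) [IsProbabilityMeasure P]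
    (N : Ω → Measure ℝ) (π : ℕ → Ω → ℝ), IsPoissonPointProcess N (powerIntensity m) P →
      IsDecreasingEnumeration π N P →
        (∀ᵐ ω ∂P, Summable (fun i => π i ω)) ∧
          HasLaw (fun ω => normalizeSeq (fun i => π i ω)) ν P

/-!
The map `g x = exp (β * (x + log β))` is increasing and carries the measure `e^{-x} dx` to
`x^{-m-1} dx` on `(0, ∞)`, where `m = 1 / β` (`map_exp_expIntensity`). By the mapping theorem
(`IsPoissonPointProcess.map`), the points `g (c i)` are therefore the ordered points of a Poisson
process with the intensity that defines `PD(m, 0)`, and normalizing them gives the sequence in the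
theorem, because `g (c i)` is a constant multiple of `exp (β * c i)`.

Two further facts make `PD(m, 0)` well defined. The law of the ordered points depends only on the
intensity (`IsDecreasingEnumeration.map_eq`): the `i`-th largest point exceeds `a` exactly when
there are at least `i` points above `a`, and the joint law of finitely many counts is determined by
independence over the atoms of the partition generated by the sets
(`IsPoissonPointProcess.map_counts_eq`). Summability follows from Campbell's formula
(`IsPoissonPointProcess.lintegral_lintegral`), since `min (exp (β * x)) 1` is integrable with
respect to `e^{-x} dx` when `β > 1`, and it passes to every other process through the common law.
A process on a space in `Type`, as the definition of `PD` asks for, is obtained by transporting the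
given one to the space of sequences (`IsDecreasingEnumeration.canonical`).
-/

/-! ### Finite-dimensional distributions of Poisson point processes -/

/-- The law of the number of points of a Poisson process in a set of intensity mass `r`: Poisson
with mean `r`, or the point mass at `∞` when `r = ∞`. -/
noncomputable def poissonCountLaw (r : ℝ≥0∞) : Measure ℝ≥0∞ :=
  if r = ∞ then Measure.dirac ∞ else (poissonMeasure r.toNNReal).map (fun n : ℕ => (n : ℝ≥0∞))

lemma lintegral_natCast_poissonMeasure (r : NNReal) :
    ∫⁻ n : ℕ, (n : ℝ≥0∞) ∂(poissonMeasure r) = r := by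
  have h1 : ∑' n : ℕ, ENNReal.ofReal (Real.exp (-r) * r ^ n / n.factorial) = 1 := by
    have h : poissonMeasure r univ = 1 := measure_univ
    simpa [poissonMeasure, Measure.sum_apply] using h
  have h2 (n : ℕ) : ENNReal.ofReal (Real.exp (-r) * r ^ (n + 1) / (n + 1).factorial) *
      ((n + 1 : ℕ) : ℝ≥0∞) = r * ENNReal.ofReal (Real.exp (-r) * r ^ n / n.factorial) := by
    rw [← ENNReal.ofReal_natCast, ← ENNReal.ofReal_coe_nnreal (p := r),
      ← ENNReal.ofReal_mul (by positivity), ← ENNReal.ofReal_mul (by positivity)]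
    congr 1
    rw [Nat.factorial_succ]
    push_cast
    field_simp
    ring
  simp only [poissonMeasure, lintegral_sum_measure, lintegral_smul_measure, lintegral_dirac,
    smul_eq_mul]
  rw [tsum_eq_zero_add' ENNReal.summable]
  simp only [h2, ENNReal.tsum_mul_left, h1]
  simp

/-- The points that belong to `A i` exactly for `i ∈ s`. As `s` varies, these sets are the atoms of
the finite partition generated by the sets `A i`. -/
def partitionAtom {ι E : Type*} (A : ι → Set E) (s : Finset ι) : Set E :=
  {x | ∀ i, x ∈ A i ↔ i ∈ s}

section partitionAtom

variable {ι E : Type*} {A : ι → Set E}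

lemma measurableSet_partitionAtom [Countable ι] [MeasurableSpace E]
    (hA : ∀ i, MeasurableSet (A i)) (s : Finset ι) : MeasurableSet (partitionAtom A s) := by
  have : partitionAtom A s = ⋂ i, {x | x ∈ A i ↔ i ∈ s} := by ext; simp [partitionAtom]
  rw [this]
  refine MeasurableSet.iInter fun i => ?_
  by_cases h : i ∈ s
  · simpa only [h, iff_true] using! hA i
  · simpa only [h, iff_false] using! (hA i).compl

lemma pairwise_disjoint_partitionAtom (A : ι → Set E) :
    Pairwise (fun s t => Disjoint (partitionAtom A s) (partitionAtom A t)) := by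
  intro s t hst
  refine Set.disjoint_left.2 fun x hs ht => hst ?_
  ext i
  rw [← hs i, ht i]

lemma biUnion_partitionAtom [Fintype ι] [DecidableEq ι] (A : ι → Set E) (i : ι) :
    ⋃ s ∈ Finset.univ.filter (fun s : Finset ι => i ∈ s), partitionAtom A s = A i := by
  classical
  ext x
  simp only [mem_iUnion, Finset.mem_filter, Finset.mem_univ, true_and, exists_prop]
  constructor
  · rintro ⟨s, his, hs⟩
    exact (hs i).2 his
  · intro hx
    exact ⟨Finset.univ.filter (fun j => x ∈ A j), by simpa using hx, fun j => by simp⟩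

end partitionAtom

namespace IsPoissonPointProcess

variable {Ω Ω' E F : Type*} [MeasurableSpace Ω] [MeasurableSpace Ω'] [MeasurableSpace E]
  [MeasurableSpace F] {N : Ω → Measure E} {N' : Ω' → Measure E} {μ : Measure E}
  {P : Measure Ω} {P' : Measure Ω'}

lemma measurable_count (hN : IsPoissonPointProcess N μ P) {A : Set E} (hA : MeasurableSet A) :
    Measurable (fun ω => N ω A) :=
  (Measure.measurable_coe hA).comp hN.measurable

lemma map_count [IsProbabilityMeasure P] (hN : IsPoissonPointProcess N μ P) {A : Set E}
    (hA : MeasurableSet A) : P.map (fun ω => N ω A) = poissonCountLaw (μ A) := by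
  unfold poissonCountLaw
  split_ifs with h
  · rw [Measure.map_congr (g := fun _ => ∞) (hN.infinite_of_infinite A hA h)]
    simp
  · exact (hN.hasLaw_poisson A hA h).map_eq

/-- Counts in arbitrary sets `A i` are sums of counts in the disjoint atoms of the finite partition
that they generate, and the latter are independent. -/
lemma map_counts [IsProbabilityMeasure P] (hN : IsPoissonPointProcess N μ P)
    {ι : Type*} [Fintype ι] [DecidableEq ι] {A : ι → Set E} (hA : ∀ i, MeasurableSet (A i)) :
    P.map (fun ω i => N ω (A i)) =
      (Measure.pi (fun s => poissonCountLaw (μ (partitionAtom A s)))).map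
        (fun f i => ∑ s with i ∈ s, f s) := by
  have hB := measurableSet_partitionAtom hA
  have hm (s : Finset ι) : Measurable (fun ω => N ω (partitionAtom A s)) :=
    hN.measurable_count (hB s)
  have hind : iIndepFun (fun s ω => N ω (partitionAtom A s)) P := by
    let e := Fintype.equivFin (Finset ι)
    have h := (hN.indep _ (fun k => partitionAtom A (e.symm k)) (fun k => hB _)
      (fun k l hkl => pairwise_disjoint_partitionAtom A (e.symm.injective.ne hkl))).precomp
        e.injective
    simpa using h
  have hpi := (iIndepFun_iff_map_fun_eq_pi_map (fun s => (hm s).aemeasurable)).1 hind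
  simp only [hN.map_count (hB _)] at hpi
  rw [← hpi, Measure.map_map (by fun_prop) (measurable_pi_lambda _ hm)]
  congr 1
  funext ω i
  rw [Function.comp_apply, ← measure_biUnion_finset
    (fun s _ t _ hst => pairwise_disjoint_partitionAtom A hst) (fun s _ => hB s),
    biUnion_partitionAtom]

/-- The joint law of the counts in finitely many sets depends only on the intensity. -/
lemma map_counts_eq [IsProbabilityMeasure P] [IsProbabilityMeasure P']
    (hN : IsPoissonPointProcess N μ P) (hN' : IsPoissonPointProcess N' μ P')
    {ι : Type*} [Fintype ι] {A : ι → Set E} (hA : ∀ i, MeasurableSet (A i)) :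
    P.map (fun ω i => N ω (A i)) = P'.map (fun ω i => N' ω (A i)) := by
  classical
  rw [hN.map_counts hA, hN'.map_counts hA]

/-- The expected number of points in a set is its intensity mass. -/
lemma bind_eq [IsProbabilityMeasure P] (hN : IsPoissonPointProcess N μ P) : P.bind N = μ := by
  ext A hA
  rw [Measure.bind_apply hA hN.measurable.aemeasurable]
  rw [← lintegral_map (f := fun x : ℝ≥0∞ => x) measurable_id (hN.measurable_count hA),
    hN.map_count hA]
  unfold poissonCountLaw
  split_ifs with hr
  · simp [hr]
  · rw [lintegral_map (f := fun x : ℝ≥0∞ => x) measurable_id (by fun_prop)]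
    simp [lintegral_natCast_poissonMeasure, ENNReal.coe_toNNReal hr]

/-- Campbell's formula. -/
lemma lintegral_lintegral [IsProbabilityMeasure P] (hN : IsPoissonPointProcess N μ P)
    {f : E → ℝ≥0∞} (hf : Measurable f) : ∫⁻ ω, ∫⁻ x, f x ∂(N ω) ∂P = ∫⁻ x, f x ∂μ := by
  rw [← hN.bind_eq, Measure.lintegral_bind hN.measurable.aemeasurable hf.aemeasurable]

/-- The mapping theorem for Poisson point processes. -/
lemma map (hN : IsPoissonPointProcess N μ P) {g : E → F} (hg : Measurable g) :
    IsPoissonPointProcess (fun ω => (N ω).map g) (μ.map g) P where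
  measurable := (Measure.measurable_map g hg).comp hN.measurable
  integer_valued := by
    filter_upwards [hN.integer_valued] with ω h A hA
    simpa [Measure.map_apply hg hA] using h _ (hg hA)
  hasLaw_poisson A hA h := by
    simp only [Measure.map_apply hg hA] at h ⊢
    exact hN.hasLaw_poisson _ (hg hA) h
  infinite_of_infinite A hA h := by
    simp only [Measure.map_apply hg hA] at h ⊢
    exact hN.infinite_of_infinite _ (hg hA) h
  indep n A hA hd := by
    simp only [Measure.map_apply hg (hA _)]
    exact hN.indep n _ (fun i => hg (hA i)) (fun i j hij => (hd hij).preimage g)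

/-- Being a Poisson point process is a property of the law, so it passes from `N` to the process
`M` on the space of values of a random element `X` when `N` is `M ∘ X`. -/
lemma of_comp [IsProbabilityMeasure P] (hN : IsPoissonPointProcess N μ P) {X : Ω → F}
    (hX : AEMeasurable X P) {M : F → Measure E} (hM : Measurable M)
    (hMX : ∀ᵐ ω ∂P, N ω = M (X ω))
    (hint : ∀ x, ∀ A : Set E, MeasurableSet A → ∃ k : ℕ∞, M x A = (k : ℝ≥0∞)) :
    IsPoissonPointProcess M μ (P.map X) where
  measurable := hM
  integer_valued := ae_of_all _ hint
  hasLaw_poisson A hA h := by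
    have hm : Measurable (fun x => M x A) := (Measure.measurable_coe hA).comp hM
    refine ⟨hm.aemeasurable, ?_⟩
    rw [AEMeasurable.map_map_of_aemeasurable hm.aemeasurable hX,
      ← (hN.hasLaw_poisson A hA h).map_eq]
    refine Measure.map_congr ?_
    filter_upwards [hMX] with ω hω
    simp [hω]
  infinite_of_infinite A hA h := by
    have hm : Measurable (fun x => M x A) := (Measure.measurable_coe hA).comp hM
    rw [ae_map_iff hX (measurableSet_eq_fun hm measurable_const)]
    filter_upwards [hMX, hN.infinite_of_infinite A hA h] with ω hω h'
    rw [← hω, h']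
  indep n A hA hd := by
    have := Measure.isProbabilityMeasure_map (μ := P) hX
    have hm (i : Fin n) : Measurable (fun x => M x (A i)) := (Measure.measurable_coe (hA i)).comp hM
    have hind := hN.indep n A hA hd
    rw [iIndepFun_iff_map_fun_eq_pi_map (fun i => (hN.measurable_count (hA i)).aemeasurable)]
      at hind
    rw [iIndepFun_iff_map_fun_eq_pi_map (fun i => (hm i).aemeasurable),
      AEMeasurable.map_map_of_aemeasurable (measurable_pi_lambda _ hm).aemeasurable hX]
    have h1 (i : Fin n) : (P.map X).map (fun x => M x (A i)) = P.map (fun ω => N ω (A i)) := by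
      rw [AEMeasurable.map_map_of_aemeasurable (hm i).aemeasurable hX]
      refine Measure.map_congr ?_
      filter_upwards [hMX] with ω hω
      simp [hω]
    simp only [h1]
    rw [← hind]
    refine Measure.map_congr ?_
    filter_upwards [hMX] with ω hω
    simp [hω]

end IsPoissonPointProcess

/-! ### Decreasing enumerations -/

/-- In a decreasing sequence, `x i` exceeds `a` exactly when at least `i + 1` of its terms do. -/
lemma Antitone.lt_apply_iff_sum_dirac {x : ℕ → ℝ} (hx : Antitone x) (a : ℝ) (i : ℕ) :
    a < x i ↔ (i + 1 : ℝ≥0∞) ≤ Measure.sum (fun j => Measure.dirac (x j)) (Ioi a) := by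
  rw [Measure.sum_apply _ measurableSet_Ioi]
  simp only [Measure.dirac_apply' _ measurableSet_Ioi]
  constructor
  · intro h
    calc (i + 1 : ℝ≥0∞) = ∑ j ∈ Finset.range (i + 1), (Ioi a).indicator 1 (x j) := by
          rw [Finset.sum_congr rfl (g := fun _ => (1 : ℝ≥0∞))]
          · simp
          · intro j hj
            have : a < x j := h.trans_le (hx (Nat.lt_succ_iff.1 (Finset.mem_range.1 hj)))
            simp [this]
      _ ≤ _ := ENNReal.sum_le_tsum _
  · intro h
    by_contra! hi
    have h0 (j : ℕ) (hj : j ∉ Finset.range i) : (Ioi a).indicator (1 : ℝ → ℝ≥0∞) (x j) = 0 := by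
      have : x j ≤ a := (hx (by simpa using hj)).trans hi
      simp [this]
    rw [tsum_eq_sum h0] at h
    have h1 : ∑ j ∈ Finset.range i, (Ioi a).indicator (1 : ℝ → ℝ≥0∞) (x j) ≤ i := by
      refine (Finset.sum_le_sum (g := fun _ => 1) fun j _ => ?_).trans (by simp)
      exact indicator_le_self' (by simp) _
    have h2 : ((i + 1 : ℕ) : ℝ≥0∞) ≤ (i : ℕ) := by exact_mod_cast h.trans h1
    exact absurd (Nat.cast_le.1 h2) (by omega)

lemma measurableSet_forall_lt (F : Finset (ℕ × ℝ)) :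
    MeasurableSet {x : ℕ → ℝ | ∀ p ∈ F, p.2 < x p.1} := by
  have : {x : ℕ → ℝ | ∀ p ∈ F, p.2 < x p.1} = ⋂ p ∈ F, {x | p.2 < x p.1} := by ext; simp
  rw [this]
  exact Finset.measurableSet_biInter _ fun p _ =>
    measurableSet_lt measurable_const (measurable_pi_apply _)

/-- A probability measure on `ℝ^ℕ` is determined by the probabilities that finitely many
coordinates exceed given levels. -/
lemma MeasureTheory.Measure.ext_of_forall_lt {ρ ρ' : Measure (ℕ → ℝ)} [IsProbabilityMeasure ρ]
    [IsProbabilityMeasure ρ']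
    (h : ∀ F : Finset (ℕ × ℝ), ρ {x | ∀ p ∈ F, p.2 < x p.1} = ρ' {x | ∀ p ∈ F, p.2 < x p.1}) :
    ρ = ρ' := by
  classical
  refine ext_of_generate_finite (range fun F : Finset (ℕ × ℝ) => {x | ∀ p ∈ F, p.2 < x p.1})
    ?_ ?_ ?_ (by simp)
  · refine le_antisymm ?_ ?_
    · refine iSup_le fun i => MeasurableSpace.comap_le_iff_le_map.2 ?_
      rw [BorelSpace.measurable_eq (α := ℝ), borel_eq_generateFrom_Ioi]
      refine MeasurableSpace.generateFrom_le ?_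
      rintro _ ⟨a, rfl⟩
      exact MeasurableSpace.measurableSet_generateFrom ⟨{(i, a)}, by ext; simp⟩
    · refine MeasurableSpace.generateFrom_le ?_
      rintro _ ⟨F, rfl⟩
      exact measurableSet_forall_lt F
  · rintro _ ⟨F, rfl⟩ _ ⟨G, rfl⟩ -
    refine ⟨F ∪ G, ?_⟩
    ext x
    simp only [Finset.mem_union, mem_ofPred_eq, mem_inter_iff]
    grind
  · rintro _ ⟨F, rfl⟩
    exact h F

lemma measurable_sum_dirac :
    Measurable (fun x : ℕ → ℝ => Measure.sum (fun i => Measure.dirac (x i))) := by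
  refine Measure.measurable_of_measurable_coe _ fun A hA => ?_
  simp only [Measure.sum_apply _ hA, Measure.dirac_apply' _ hA]
  exact Measurable.tsum fun i =>
    (measurable_one.indicator hA).comp (measurable_pi_apply i)

lemma exists_sum_dirac_eq_natCast (x : ℕ → ℝ) {A : Set ℝ} (hA : MeasurableSet A) :
    ∃ k : ℕ∞, Measure.sum (fun i => Measure.dirac (x i)) A = (k : ℝ≥0∞) := by
  refine ⟨{i | x i ∈ A}.encard, ?_⟩
  rw [Measure.sum_apply _ hA, ← ENNReal.tsum_set_one, tsum_subtype _ (fun _ => (1 : ℝ≥0∞))]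
  refine tsum_congr fun i => ?_
  simp [Measure.dirac_apply' _ hA, indicator]

namespace IsDecreasingEnumeration

variable {Ω Ω' : Type*} [MeasurableSpace Ω] [MeasurableSpace Ω'] {N : Ω → Measure ℝ}
  {N' : Ω' → Measure ℝ} {P : Measure Ω} {P' : Measure Ω'} {c : ℕ → Ω → ℝ} {c' : ℕ → Ω' → ℝ}
  {μ : Measure ℝ}

lemma aemeasurable_pi (hc : IsDecreasingEnumeration c N P) :
    AEMeasurable (fun ω i => c i ω) P :=
  aemeasurable_pi_lambda _ hc.aemeasurable

lemma map (hc : IsDecreasingEnumeration c N P) {g : ℝ → ℝ} (hg : Monotone g) :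
    IsDecreasingEnumeration (fun i ω => g (c i ω)) (fun ω => (N ω).map g) P where
  aemeasurable i := hg.measurable.comp_aemeasurable (hc.aemeasurable i)
  antitone := by
    filter_upwards [hc.antitone] with ω h i j hij
    exact hg (h hij)
  eq_sum_dirac := by
    filter_upwards [hc.eq_sum_dirac] with ω h
    rw [h, Measure.map_sum hg.measurable.aemeasurable]
    simp [Measure.map_dirac' hg.measurable]

/-- Probabilities of cylinder events for the ordered points are probabilities about counts in
half-lines. -/
lemma map_cylinder (hc : IsDecreasingEnumeration c N P) (hN : Measurable N)
    (F : Finset (ℕ × ℝ)) :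
    P.map (fun ω i => c i ω) {x | ∀ p ∈ F, p.2 < x p.1} =
      P.map (fun ω (p : F) => N ω (Ioi p.1.2)) {f | ∀ p : F, (p.1.1 + 1 : ℝ≥0∞) ≤ f p} := by
  have h2 : MeasurableSet {f : F → ℝ≥0∞ | ∀ p : F, (p.1.1 + 1 : ℝ≥0∞) ≤ f p} := by
    have : {f : F → ℝ≥0∞ | ∀ p : F, (p.1.1 + 1 : ℝ≥0∞) ≤ f p} =
      ⋂ p : F, {f | (p.1.1 + 1 : ℝ≥0∞) ≤ f p} := by ext; simp
    rw [this]
    exact MeasurableSet.iInter fun p => measurableSet_le measurable_const (measurable_pi_apply _)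
  rw [Measure.map_apply_of_aemeasurable hc.aemeasurable_pi
    (measurableSet_forall_lt F), Measure.map_apply
    (measurable_pi_lambda _ fun p : F =>
      (Measure.measurable_coe (measurableSet_Ioi (a := p.1.2))).comp hN :
      Measurable fun ω (p : F) => N ω (Ioi p.1.2)) h2]
  refine measure_congr ?_
  filter_upwards [hc.antitone, hc.eq_sum_dirac] with ω ha hs
  refine propext ?_
  change (∀ p ∈ F, p.2 < c p.1 ω) ↔ ∀ p : F, (p.1.1 + 1 : ℝ≥0∞) ≤ N ω (Ioi p.1.2)
  rw [hs, Subtype.forall]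
  exact forall₂_congr fun p _ => ha.lt_apply_iff_sum_dirac _ _

/-- The law of the ordered points of a Poisson point process depends only on the intensity. -/
lemma map_eq [IsProbabilityMeasure P] [IsProbabilityMeasure P']
    (hc : IsDecreasingEnumeration c N P) (hN : IsPoissonPointProcess N μ P)
    (hc' : IsDecreasingEnumeration c' N' P') (hN' : IsPoissonPointProcess N' μ P') :
    P.map (fun ω i => c i ω) = P'.map (fun ω i => c' i ω) := by
  have := Measure.isProbabilityMeasure_map (μ := P) hc.aemeasurable_pi
  have := Measure.isProbabilityMeasure_map (μ := P') hc'.aemeasurable_pi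
  refine Measure.ext_of_forall_lt fun F => ?_
  rw [hc.map_cylinder hN.measurable, hc'.map_cylinder hN'.measurable,
    hN.map_counts_eq hN' fun _ => measurableSet_Ioi]

/-- A Poisson point process with a decreasing enumeration can be realized on the space of real
sequences, with the coordinates as its points. -/
lemma canonical [IsProbabilityMeasure P] (hc : IsDecreasingEnumeration c N P)
    (hN : IsPoissonPointProcess N μ P) :
    IsPoissonPointProcess (fun x : ℕ → ℝ => Measure.sum (fun i => Measure.dirac (x i))) μ
        (P.map (fun ω i => c i ω)) ∧
      IsDecreasingEnumeration (fun i (x : ℕ → ℝ) => x i)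
        (fun x => Measure.sum (fun i => Measure.dirac (x i))) (P.map (fun ω i => c i ω)) where
  left := hN.of_comp hc.aemeasurable_pi measurable_sum_dirac hc.eq_sum_dirac
    fun x _ hA => exists_sum_dirac_eq_natCast x hA
  right :=
    { aemeasurable := fun i => (measurable_pi_apply i).aemeasurable
      antitone := by
        have hmeas : MeasurableSet {x : ℕ → ℝ | Antitone fun i => x i} := by
          have : {x : ℕ → ℝ | Antitone fun i => x i} = ⋂ i : ℕ, {x | x (i + 1) ≤ x i} := by
            ext x
            simp only [mem_ofPred_eq, mem_iInter]
            exact ⟨fun h i => h i.le_succ, fun h => antitone_nat_of_succ_le h⟩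
          rw [this]
          exact MeasurableSet.iInter fun i =>
            measurableSet_le (measurable_pi_apply _) (measurable_pi_apply _)
        exact (ae_map_iff hc.aemeasurable_pi hmeas).2 hc.antitone
      eq_sum_dirac := ae_of_all _ fun _ => rfl }

/-- By Campbell's formula, a nonnegative function is almost surely summable over the points if it
is integrable against the intensity. -/
lemma ae_summable [IsProbabilityMeasure P] (hc : IsDecreasingEnumeration c N P)
    (hN : IsPoissonPointProcess N μ P) {f : ℝ → ℝ} (hf : Measurable f) (hf0 : ∀ x, 0 ≤ f x)
    (hint : ∫⁻ x, ENNReal.ofReal (f x) ∂μ ≠ ∞) : ∀ᵐ ω ∂P, Summable (fun i => f (c i ω)) := by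
  rw [← hN.lintegral_lintegral hf.ennreal_ofReal] at hint
  have hm : Measurable (fun ω => ∫⁻ x, ENNReal.ofReal (f x) ∂(N ω)) :=
    (Measure.measurable_lintegral hf.ennreal_ofReal).comp hN.measurable
  filter_upwards [ae_lt_top hm hint, hc.eq_sum_dirac] with ω h hs
  rw [hs, lintegral_sum_measure] at h
  simp only [lintegral_dirac] at h
  simpa [ENNReal.toReal_ofReal (hf0 _)] using ENNReal.summable_toReal h.ne

end IsDecreasingEnumeration

/-! ### The exponential intensity -/

lemma lintegral_min_exp_expIntensity_ne_top {β : ℝ} (hβ : 1 < β) :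
    ∫⁻ x, ENNReal.ofReal (min (Real.exp (β * x)) 1) ∂expIntensity ≠ ∞ := by
  rw [expIntensity, lintegral_withDensity_eq_lintegral_mul _ (by fun_prop) (by fun_prop)]
  simp only [Pi.mul_apply]
  simp_rw [← ENNReal.ofReal_mul (Real.exp_nonneg _)]
  rw [← lintegral_add_compl _ (measurableSet_Iic (a := (0 : ℝ))), compl_Iic]
  refine ENNReal.add_ne_top.2 ⟨ne_of_lt ?_, ne_of_lt ?_⟩
  · refine lt_of_le_of_lt (lintegral_mono fun x => ENNReal.ofReal_le_ofReal ?_)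
      (integrableOn_exp_mul_Iic (sub_pos.2 hβ) 0).lintegral_lt_top
    calc Real.exp (-x) * min (Real.exp (β * x)) 1 ≤ Real.exp (-x) * Real.exp (β * x) := by
          gcongr; exact min_le_left _ _
      _ = Real.exp ((β - 1) * x) := by rw [← Real.exp_add]; ring_nf
  · refine lt_of_le_of_lt (lintegral_mono fun x => ENNReal.ofReal_le_ofReal ?_)
      (integrableOn_exp_neg_Ioi 0).lintegral_lt_top
    exact mul_le_of_le_one_right (Real.exp_nonneg _) (min_le_right _ _)

/-- The shift by `log β` absorbs the factor `1 / β` which the change of variables `x ↦ exp (β x)`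
leaves in front of the density. -/
lemma map_exp_expIntensity {β : ℝ} (hβ : 0 < β) :
    expIntensity.map (fun x => Real.exp (β * (x + Real.log β))) = powerIntensity (1 / β) := by
  set g : ℝ → ℝ := fun x => Real.exp (β * (x + Real.log β)) with hg
  have hgm : Measurable g := by fun_prop
  have hderiv (x : ℝ) : HasDerivAt g (β * g x) x := by
    have := (((hasDerivAt_id x).add_const (Real.log β)).const_mul β).exp
    simpa [hg, mul_comm] using this
  have hinj : Function.Injective g := by
    intro x y h
    have := mul_left_cancel₀ hβ.ne' (Real.exp_injective h)
    linarith
  have himage (A : Set ℝ) : g '' (g ⁻¹' A) = A ∩ Ioi 0 := by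
    rw [image_preimage_eq_inter_range]
    congr 1
    ext y
    refine ⟨?_, fun hy => ⟨Real.log y / β - Real.log β, ?_⟩⟩
    · rintro ⟨x, rfl⟩
      exact Real.exp_pos _
    · simp only [hg, sub_add_cancel]
      rw [mul_div_cancel₀ _ hβ.ne', Real.exp_log hy]
  ext A hA
  rw [Measure.map_apply hgm hA, expIntensity, withDensity_apply _ (hgm hA), powerIntensity,
    withDensity_apply _ hA, Measure.restrict_restrict hA, ← himage,
    lintegral_image_eq_lintegral_abs_deriv_mul (hgm hA)
      (fun x _ => (hderiv x).hasDerivWithinAt) hinj.injOn]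
  refine lintegral_congr fun x => ?_
  rw [← ENNReal.ofReal_mul (abs_nonneg _), abs_of_pos (mul_pos hβ (Real.exp_pos _))]
  congr 1
  simp only [hg]
  rw [← Real.exp_mul, mul_assoc, ← Real.exp_add]
  have : β * (x + Real.log β) + β * (x + Real.log β) * (-(1 / β) - 1) = -x - Real.log β := by
    field_simp
    ring
  rw [this, Real.exp_sub, Real.exp_log hβ]
  field_simp

/-! ### Normalization and the Poisson–Dirichlet law -/

lemma measurable_normalizeSeq : Measurable normalizeSeq := by
  unfold normalizeSeq
  have : Measurable fun x : ℕ → ℝ => ∑' j, x j := Measurable.tsum fun i => measurable_pi_apply i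
  fun_prop

lemma measurableSet_summable : MeasurableSet {x : ℕ → ℝ | Summable x} := by
  have h (x : ℕ → ℝ) : Summable x ↔ ∑' i, ENNReal.ofReal |x i| ≠ ∞ := by
    rw [← summable_abs_iff]
    refine ⟨fun hx => hx.tsum_ofReal_ne_top, fun hx => ?_⟩
    simpa [ENNReal.toReal_ofReal] using ENNReal.summable_toReal hx
  simp only [h]
  have hm : Measurable fun x : ℕ → ℝ => ∑' i, ENNReal.ofReal |x i| :=
    Measurable.tsum fun i => by fun_prop
  exact (measurableSet_eq_fun hm measurable_const).compl

lemma normalizeSeq_const_mul {a : ℝ} (ha : a ≠ 0) (x : ℕ → ℝ) :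
    normalizeSeq (fun i => a * x i) = normalizeSeq x := by
  funext i
  simp only [normalizeSeq, tsum_mul_left, mul_div_mul_left _ _ ha]

/-- The points of the Poisson process with intensity `e^{-x} dx` are almost surely summable after
`x ↦ exp (β * x)`: truncating this function at `1` makes it integrable, and truncation changes
only finitely many terms of the series. -/
lemma IsDecreasingEnumeration.ae_summable_exp {Ω : Type*} [MeasurableSpace Ω] {P : Measure Ω}
    [IsProbabilityMeasure P] {N : Ω → Measure ℝ} {c : ℕ → Ω → ℝ}
    (hc : IsDecreasingEnumeration c N P) (hN : IsPoissonPointProcess N expIntensity P)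
    {β : ℝ} (hβ : 1 < β) : ∀ᵐ ω ∂P, Summable (fun j => Real.exp (β * c j ω)) := by
  filter_upwards [hc.ae_summable hN (f := fun x => min (Real.exp (β * x)) 1) (by fun_prop)
    (fun x => by positivity) (lintegral_min_exp_expIntensity_ne_top hβ)] with ω h
  refine (summable_congr_cofinite ?_).1 h
  filter_upwards [h.tendsto_cofinite_zero.eventually_lt_const one_pos] with j hj
  exact min_eq_left ((min_lt_iff.1 hj).resolve_right (lt_irrefl 1)).le

theorem proposition3p2 {Ω : Type*} [MeasurableSpace Ω] (P : Measure Ω) [IsProbabilityMeasure P]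
    (β : ℝ) (hβ : 1 < β) (N : Ω → Measure ℝ) (hN : IsPoissonPointProcess N expIntensity P)
    (c : ℕ → Ω → ℝ) (hc : IsDecreasingEnumeration c N P) :
    (∀ᵐ ω ∂P, Summable (fun j => Real.exp (β * c j ω))) ∧
      ∃ ν : Measure (ℕ → ℝ), IsPoissonDirichlet (1 / β) ν ∧
        HasLaw (fun ω i => Real.exp (β * c i ω) / ∑' j, Real.exp (β * c j ω)) ν P := by
  have hβ0 : 0 < β := one_pos.trans hβ
  have hsum := hc.ae_summable_exp hN hβ
  refine ⟨hsum, ?_⟩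
  set a : ℝ := Real.exp (β * Real.log β)
  have ha : a ≠ 0 := (Real.exp_pos _).ne'
  have hg (x : ℝ) : Real.exp (β * (x + Real.log β)) = a * Real.exp (β * x) := by
    rw [mul_add, Real.exp_add, mul_comm]
  -- The points `a * exp (β * c i)` form a Poisson process with exactly the intensity of `PD`.
  have hN₁ := hN.map (g := fun x => Real.exp (β * (x + Real.log β))) (by fun_prop)
  rw [map_exp_expIntensity hβ0] at hN₁
  have hc₁ := hc.map (g := fun x => Real.exp (β * (x + Real.log β)))
    (fun x y h => Real.exp_le_exp.2 (by gcongr))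
  simp only [hg] at hN₁ hc₁
  obtain ⟨hNc, hcc⟩ := hc₁.canonical hN₁
  set ρ := P.map (fun ω i => a * Real.exp (β * c i ω))
  have hρ : IsProbabilityMeasure ρ := Measure.isProbabilityMeasure_map hc₁.aemeasurable_pi
  have hlaw {v : Ω → ℕ → ℝ} (hv : ∀ ω, v ω = normalizeSeq fun i => a * Real.exp (β * c i ω)) :
      HasLaw v (ρ.map normalizeSeq) P := by
    obtain rfl : v = fun ω => normalizeSeq fun i => a * Real.exp (β * c i ω) := funext hv
    refine ⟨measurable_normalizeSeq.comp_aemeasurable hc₁.aemeasurable_pi, ?_⟩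
    exact (AEMeasurable.map_map_of_aemeasurable measurable_normalizeSeq.aemeasurable
      hc₁.aemeasurable_pi).symm
  have hρsum : ∀ᵐ x ∂ρ, Summable x := by
    refine (ae_map_iff hc₁.aemeasurable_pi measurableSet_summable).2 ?_
    filter_upwards [hsum] with ω h using h.mul_left a
  refine ⟨ρ.map normalizeSeq, ⟨⟨ℕ → ℝ, inferInstance, ρ, _, _, hρ, hNc, hcc⟩, ?_⟩,
    hlaw fun ω => (normalizeSeq_const_mul ha _).symm⟩
  intro Ω' _ P' _ N' π hN' hπ
  have heq : P'.map (fun ω i => π i ω) = ρ := hπ.map_eq hN' hc₁ hN₁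
  refine ⟨?_, measurable_normalizeSeq.comp_aemeasurable hπ.aemeasurable_pi, ?_⟩
  · rw [← heq] at hρsum
    exact ae_of_ae_map hπ.aemeasurable_pi hρsum
  · rw [← heq, AEMeasurable.map_map_of_aemeasurable measurable_normalizeSeq.aemeasurable
      hπ.aemeasurable_pi]
    rfl
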